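/- Fix an integer $p\ge 2$, a point $\theta$ of the unit sphere $\mathcal S^{p-1}\subset\mathbb R^p$, and a function $f:\mathbb R\to[0,\infty)$ that is monotone increasing, twice differentiable at $0$, and satisfies $f(0)=f'(0)=1$. For $\kappa\in\mathbb R$, let $\mathrm P_{\theta,\kappa,f}$ be the probability measure on $\mathcal S^{p-1}$ with density $$ x\mapsto \frac{c_{p,\kappa,f}\,\Gamma(\frac{p-1}{2})}{2\pi^{(p-1)/2}}\, f\big(\kappa (x'\theta)^2\big), \qquad c_{p,\kappa,f}=1\Big/\int_{-1}^1(1-s^2)^{(p-3)/2}f(\kappa s^2)\,ds, $$ with respect to the surface area measure (for $\kappa=0$ this is the uniform distribution). Let $(\tau_n)$ be a real sequence that converges to $\tau\in\mathbb R$, let $\kappa_n=\tau_n p/\sqrt n$, and, for each $n$, let $\mathbf X_{n1},\dots,\mathbf X_{nn}$ be independent random vectors with common distribution $\mathrm P_{\theta,\kappa_n,f}$; write $\mathrm P^{(n)}_{\theta,\kappa_n,f}$ for the corresponding probability. Put $$ \mathbf S_n=\frac1n\sum_{i=1}^n\mathbf X_{ni}\mathbf X_{ni}',\qquad Q^{(n)}=\frac{np(p+2)}{2}\Big(\mathrm{tr}[\mathbf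 S_n^2]-\frac1p\Big),\qquad d_p=\frac{p(p+1)}2-1 . $$ Let $\chi^2_\ell(\delta)$ denote the noncentral chi-square distribution with $\ell$ degrees of freedom and noncentrality parameter $\delta$ (the law of $\sum_{i=1}^{\ell}Z_i^2$ with $Z_i\sim\mathcal N(m_i,1)$ independent and $\sum_i m_i^2=\delta$), let $\Psi_\ell(\cdot\,;\delta)$ be its cumulative distribution function, and let $\chi^2_{\ell,1-\alpha}$ be the upper $\alpha$-quantile of $\chi^2_\ell(0)$. Then, as $n\to\infty$ under $\mathrm P^{(n)}_{\theta,\kappa_n,f}$, $$ Q^{(n)}\ \xrightarrow{\ \mathcal D\ }\ \chi^2_{d_p}\Big(\frac{2(p-1)\tau^2}{p+2}\Big), $$ and, for every $\alpha\in(0,1)$, the asymptotic power of the Bingham test is $$ \lim_{n\to\infty}\mathrm P^{(n)}_{\theta,\kappa_n,f}\big[Q^{(n)}>\chi^2_{d_p,1-\alpha}\big] =1-\Psi_{d_p}\Big(\chi^2_{d_p,1-\alpha};\frac{2(p-1)\tau^2}{p+2}\Big). $$ -/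

import Mathlib

open MeasureTheory ProbabilityTheory Filter Topology

/-- The unit sphere of `ℝ^p`, with the Euclidean norm. -/
abbrev USphere (p : ℕ) : Type := Metric.sphere (0 : EuclideanSpace ℝ (Fin p)) 1

/-- The class of angular functions: nonnegative, monotone increasing, twice differentiable at `0`
(differentiable near `0`, with a derivative that is differentiable at `0`), and normalized by
`f 0 = f' 0 = 1`. -/
structure IsAngularFunction (f : ℝ → ℝ) : Prop where
  nonneg : ∀ x, 0 ≤ f x
  mono : Monotone f
  differentiable_near : ∀ᶠ x in 𝓝 (0 : ℝ), DifferentiableAt ℝ f x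
  twice_differentiable : DifferentiableAt ℝ (deriv f) 0
  map_zero : f 0 = 1
  deriv_zero : deriv f 0 = 1

/-- The normalizing constant `c_{p,κ,f} = 1 / ∫_{-1}^1 (1 - s²)^{(p-3)/2} f(κ s²) ds`. -/
noncomputable def axialConst (p : ℕ) (κ : ℝ) (f : ℝ → ℝ) : ℝ :=
  1 / ∫ s in (-1 : ℝ)..1, (1 - s ^ 2) ^ (((p : ℝ) - 3) / 2) * f (κ * s ^ 2)

/-- The axial density
`x ↦ c_{p,κ,f} Γ((p-1)/2) / (2 π^{(p-1)/2}) f(κ (x'θ)²)` on the unit sphere. -/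
noncomputable def axialDensity {p : ℕ} (θ : USphere p) (κ : ℝ) (f : ℝ → ℝ) (x : USphere p) : ℝ :=
  axialConst p κ f * Real.Gamma (((p : ℝ) - 1) / 2) / (2 * Real.pi ^ (((p : ℝ) - 1) / 2)) *
    f (κ * (inner ℝ (x : EuclideanSpace ℝ (Fin p)) (θ : EuclideanSpace ℝ (Fin p))) ^ 2)

/-- The axial distribution: `axialDensity` with respect to the surface area measure. -/
noncomputable def axialLaw {p : ℕ} (θ : USphere p) (κ : ℝ) (f : ℝ → ℝ) : Measure (USphere p) :=
  ((volume : Measure (EuclideanSpace ℝ (Fin p))).toSphere).withDensity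
    (fun x => ENNReal.ofReal (axialDensity θ κ f x))

/-- The sample covariance matrix about the origin, `S_n = n⁻¹ ∑ X_i X_i'`. -/
noncomputable def sampleCov {p n : ℕ} (x : Fin n → USphere p) : Matrix (Fin p) (Fin p) ℝ :=
  (n : ℝ)⁻¹ • ∑ i, Matrix.vecMulVec
    (fun j => (x i : EuclideanSpace ℝ (Fin p)) j) (fun j => (x i : EuclideanSpace ℝ (Fin p)) j)

/-- The Bingham statistic `Q = (n p (p+2) / 2) (tr[S_n²] - 1/p)`. -/
noncomputable def binghamStat {p n : ℕ} (x : Fin n → USphere p) : ℝ :=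
  (n : ℝ) * p * (p + 2) / 2 * ((sampleCov x ^ 2).trace - 1 / (p : ℝ))

/-- The noncentral chi-square distribution with `d ≥ 1` degrees of freedom and noncentrality
parameter `δ ≥ 0`: the law of `∑ Z_i²`, where `Z_1, …, Z_d` are independent normal variables with
variance `1`, `Z_1` has mean `√δ` and the others have mean `0`. -/
noncomputable def noncentralChiSq (d : ℕ) (δ : ℝ) : Measure ℝ :=
  (Measure.pi (fun i : Fin d => gaussianReal (if (i : ℕ) = 0 then √δ else 0) 1)).map
    (fun z => ∑ i, z i ^ 2)

instance noncentralChiSq_isProbabilityMeasure (d : ℕ) (δ : ℝ) :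
    IsProbabilityMeasure (noncentralChiSq d δ) :=
  Measure.isProbabilityMeasure_map
    (Finset.measurable_sum _ fun i _ => (measurable_pi_apply i).pow_const 2).aemeasurable

/-- The quantile of order `u` of a probability measure on `ℝ`. -/
noncomputable def realQuantile (μ : Measure ℝ) (u : ℝ) : ℝ := sInf {x : ℝ | u ≤ cdf μ x}

/-- The upper `α`-quantile of the (central) chi-square distribution with `d` degrees of freedom. -/
noncomputable def chiSqUpperQuantile (d : ℕ) (α : ℝ) : ℝ :=
  realQuantile (noncentralChiSq d 0) (1 - α)

/-- The number of degrees of freedom `d_p = p(p+1)/2 - 1`. -/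
def binghamDof (p : ℕ) : ℕ := p * (p + 1) / 2 - 1

/-! Write `Y(x)` for the coordinates of `√(p(p+2)/2) (xx' - I/p)` in an orthonormal basis of the
traceless symmetric matrices, a space of dimension `d_p`. Since `S_n` has trace one, the Bingham
statistic is exactly `‖n^{-1/2} ∑ Y(X_i)‖²` (`binghamStat_eq`). Rotation invariance determines the
fourth moments of the uniform law (`integral_coord_four`), and these make `Y` centered with identity
covariance under uniformity.

Under the alternatives, characteristic functions are computed directly, without a contiguity
argument. Relative to the uniform law the density is `f(κ_n (x'θ)²)` divided by its mean, so each
summand has characteristic function `1 + z_n/n`. The first-order expansion of `f` at 0 gives the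
limit of `z_n` (`tendsto_nat_mul_integral_tilted`): the quadratic term of the exponential sees only
the uniform law and gives `-‖t‖²/2`, while the linear term has mean zero under uniformity and so
retains only the tilt, giving `iτp E[⟨Y,t⟩ (x'θ)²]`. Hence `n^{-1/2} ∑ Y(X_i)` is asymptotically
Gaussian with identity covariance and mean proportional to `θθ' - I/p`; the squared length of that
mean is the noncentrality. Continuous mapping gives the limit law, and its lack of atoms gives the
power. -/

/-! ### Uniform law on the sphere and its rotation invariance -/

/-- The uniform distribution on the unit sphere. -/
noncomputable def uniformSphere (p : ℕ) : Measure (USphere p) :=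
  ((volume : Measure (EuclideanSpace ℝ (Fin p))).toSphere Set.univ)⁻¹ •
    (volume : Measure (EuclideanSpace ℝ (Fin p))).toSphere

theorem isProbabilityMeasure_uniformSphere {p : ℕ} (hp : 2 ≤ p) :
    IsProbabilityMeasure (uniformSphere p) := by
  have : Nonempty (Fin p) := ⟨⟨0, by omega⟩⟩
  refine ⟨?_⟩
  rw [uniformSphere, Measure.smul_apply, smul_eq_mul]
  refine ENNReal.inv_mul_cancel ?_ (measure_ne_top _ _)
  rw [ne_eq, Measure.measure_univ_eq_zero]
  exact Measure.toSphere_ne_zero _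

/-- The action of a linear isometry on the unit sphere. -/
noncomputable def sphereMap {p : ℕ} (L : EuclideanSpace ℝ (Fin p) ≃ₗᵢ[ℝ] EuclideanSpace ℝ (Fin p))
    (x : USphere p) : USphere p :=
  ⟨L x, by simp⟩

theorem continuous_sphereMap {p : ℕ}
    (L : EuclideanSpace ℝ (Fin p) ≃ₗᵢ[ℝ] EuclideanSpace ℝ (Fin p)) :
    Continuous (sphereMap L) :=
  (L.continuous.comp continuous_subtype_val).subtype_mk _

-- The surface measure of `s` is, up to a constant, the volume of the cone `(0,1) • s`. A linear
-- isometry commutes with forming this cone and preserves volume.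
open scoped Pointwise in
theorem measurePreserving_sphereMap_toSphere {p : ℕ}
    (L : EuclideanSpace ℝ (Fin p) ≃ₗᵢ[ℝ] EuclideanSpace ℝ (Fin p)) :
    MeasurePreserving (sphereMap L) (volume : Measure (EuclideanSpace ℝ (Fin p))).toSphere
      (volume : Measure (EuclideanSpace ℝ (Fin p))).toSphere := by
  have hm := (continuous_sphereMap L).measurable
  refine ⟨hm, ?_⟩
  ext s hs
  rw [Measure.map_apply hm hs, Measure.toSphere_apply' _ hs, Measure.toSphere_apply' _ (hm hs)]
  congr 1
  have : Set.Ioo (0 : ℝ) 1 • (Subtype.val '' (sphereMap L ⁻¹' s)) =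
      L ⁻¹' (Set.Ioo (0 : ℝ) 1 • (Subtype.val '' s)) := by
    ext y
    simp only [Set.mem_smul, Set.mem_image, Set.mem_preimage]
    constructor
    · rintro ⟨r, hr, _, ⟨x, hx, rfl⟩, rfl⟩
      exact ⟨r, hr, _, ⟨_, hx, rfl⟩, by simp [sphereMap]⟩
    · rintro ⟨r, hr, _, ⟨x, hx, rfl⟩, h⟩
      refine ⟨r, hr, _, ⟨sphereMap L.symm x, ?_, rfl⟩, ?_⟩
      · convert hx
        ext1
        simp [sphereMap]
      · apply L.injective
        simpa [sphereMap] using h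
  rw [this, (L.measurePreserving).measure_preimage_emb L.toHomeomorph.measurableEmbedding]

theorem measurePreserving_sphereMap {p : ℕ}
    (L : EuclideanSpace ℝ (Fin p) ≃ₗᵢ[ℝ] EuclideanSpace ℝ (Fin p)) :
    MeasurePreserving (sphereMap L) (uniformSphere p) (uniformSphere p) :=
  (measurePreserving_sphereMap_toSphere L).smul_measure _

/-! ### Second and fourth moments of the uniform law -/

section Moments

variable {p : ℕ}

theorem integrable_of_continuous_uniformSphere (hp : 2 ≤ p) {g : USphere p → ℝ}
    (hg : Continuous g) : Integrable g (uniformSphere p) := by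
  have := isProbabilityMeasure_uniformSphere hp
  exact hg.integrable_of_hasCompactSupport (HasCompactSupport.of_compactSpace g)

local notation "⟪" x ", " y "⟫" => inner ℝ x y

/-- The reflection in the hyperplane orthogonal to `v - w` carries `v` to `w` and preserves the
uniform law. -/
theorem integral_inner_pow_eq_of_norm_eq (k : ℕ) {v w : EuclideanSpace ℝ (Fin p)}
    (h : ‖v‖ = ‖w‖) :
    ∫ x : USphere p, ⟪(x : EuclideanSpace ℝ (Fin p)), v⟫ ^ k ∂(uniformSphere p) =
      ∫ x : USphere p, ⟪(x : EuclideanSpace ℝ (Fin p)), w⟫ ^ k ∂(uniformSphere p) := by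
  set L := (ℝ ∙ (v - w))ᗮ.reflection
  have hL : L v = w := Submodule.reflection_sub h
  have hc : Continuous fun x : USphere p => ⟪(x : EuclideanSpace ℝ (Fin p)), w⟫ ^ k := by fun_prop
  have hmp := measurePreserving_sphereMap L
  conv_rhs => rw [← hmp.map_eq, integral_map hmp.aemeasurable hc.aestronglyMeasurable]
  refine integral_congr_ae (.of_forall fun x => ?_)
  simp only [sphereMap, ← hL, LinearIsometryEquiv.inner_map_map]

/-- By invariance and homogeneity the quartic form is a multiple of `‖v‖⁴`. The factor 3 is split
off so that the polarized form has coefficient `K`. -/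
theorem exists_integral_inner_pow_four (hp : 2 ≤ p) :
    ∃ K : ℝ, ∀ v : EuclideanSpace ℝ (Fin p),
      ∫ x : USphere p, ⟪(x : EuclideanSpace ℝ (Fin p)), v⟫ ^ 4 ∂(uniformSphere p) =
        3 * K * ⟪v, v⟫ ^ 2 := by
  let e : EuclideanSpace ℝ (Fin p) := EuclideanSpace.single ⟨0, by omega⟩ 1
  refine ⟨(∫ x : USphere p, ⟪(x : EuclideanSpace ℝ (Fin p)), e⟫ ^ 4 ∂(uniformSphere p)) / 3,
    fun v => ?_⟩
  rw [integral_inner_pow_eq_of_norm_eq 4 (w := ‖v‖ • e) (by simp [e, norm_smul])]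
  simp only [inner_smul_right, mul_pow, integral_const_mul, real_inner_self_eq_norm_sq]
  ring

/-- Polarization in two stages: fourth powers of `a ± b` give `a²b²`, then squares of `a ± b` and `c
± d` give the full product. -/
theorem integral_inner_mul_inner_four (hp : 2 ≤ p) {K : ℝ}
    (hK : ∀ v : EuclideanSpace ℝ (Fin p),
      ∫ x : USphere p, ⟪(x : EuclideanSpace ℝ (Fin p)), v⟫ ^ 4 ∂(uniformSphere p) =
        3 * K * ⟪v, v⟫ ^ 2) (a b c d : EuclideanSpace ℝ (Fin p)) :
    ∫ x : USphere p, ⟪(x : EuclideanSpace ℝ (Fin p)), a⟫ * ⟪(x : EuclideanSpace ℝ (Fin p)), b⟫ *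
        (⟪(x : EuclideanSpace ℝ (Fin p)), c⟫ * ⟪(x : EuclideanSpace ℝ (Fin p)), d⟫)
        ∂(uniformSphere p) =
      K * (⟪a, b⟫ * ⟪c, d⟫ + ⟪a, c⟫ * ⟪b, d⟫ + ⟪a, d⟫ * ⟪b, c⟫) := by
  have hsq (a b : EuclideanSpace ℝ (Fin p)) :
      ∫ x : USphere p, ⟪(x : EuclideanSpace ℝ (Fin p)), a⟫ ^ 2 *
        ⟪(x : EuclideanSpace ℝ (Fin p)), b⟫ ^ 2 ∂(uniformSphere p) =
      K * (⟪a, a⟫ * ⟪b, b⟫ + 2 * ⟪a, b⟫ ^ 2) := by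
    have h1 (x : USphere p) : ⟪(x : EuclideanSpace ℝ (Fin p)), a⟫ ^ 2 *
        ⟪(x : EuclideanSpace ℝ (Fin p)), b⟫ ^ 2 =
        12⁻¹ * (⟪(x : EuclideanSpace ℝ (Fin p)), a + b⟫ ^ 4 +
          ⟪(x : EuclideanSpace ℝ (Fin p)), a - b⟫ ^ 4 -
          2 * ⟪(x : EuclideanSpace ℝ (Fin p)), a⟫ ^ 4 -
          2 * ⟪(x : EuclideanSpace ℝ (Fin p)), b⟫ ^ 4) := by
      simp only [inner_add_right, inner_sub_right]
      ring
    simp only [h1]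
    rw [integral_const_mul, integral_sub, integral_sub, integral_add, integral_const_mul,
      integral_const_mul, hK, hK, hK, hK]
    any_goals exact integrable_of_continuous_uniformSphere hp (by fun_prop)
    simp only [inner_add_right, inner_sub_right, inner_add_left, inner_sub_left,
      real_inner_comm b a]
    ring
  have h2 (x : USphere p) : ⟪(x : EuclideanSpace ℝ (Fin p)), a⟫ *
      ⟪(x : EuclideanSpace ℝ (Fin p)), b⟫ *
        (⟪(x : EuclideanSpace ℝ (Fin p)), c⟫ * ⟪(x : EuclideanSpace ℝ (Fin p)), d⟫) =
      16⁻¹ * ((⟪(x : EuclideanSpace ℝ (Fin p)), a + b⟫ ^ 2 *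
          ⟪(x : EuclideanSpace ℝ (Fin p)), c + d⟫ ^ 2 -
        ⟪(x : EuclideanSpace ℝ (Fin p)), a + b⟫ ^ 2 *
          ⟪(x : EuclideanSpace ℝ (Fin p)), c - d⟫ ^ 2) -
        (⟪(x : EuclideanSpace ℝ (Fin p)), a - b⟫ ^ 2 *
          ⟪(x : EuclideanSpace ℝ (Fin p)), c + d⟫ ^ 2 -
        ⟪(x : EuclideanSpace ℝ (Fin p)), a - b⟫ ^ 2 *
          ⟪(x : EuclideanSpace ℝ (Fin p)), c - d⟫ ^ 2)) := by
    simp only [inner_add_right, inner_sub_right]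
    ring
  simp only [h2]
  rw [integral_const_mul, integral_sub, integral_sub, integral_sub, hsq, hsq, hsq, hsq]
  any_goals exact integrable_of_continuous_uniformSphere hp (by fun_prop)
  simp only [inner_add_right, inner_sub_right, inner_add_left, inner_sub_left,
    real_inner_comm b a, real_inner_comm d c]
  ring

theorem USphere.sum_sq (x : USphere p) : ∑ i, (x : EuclideanSpace ℝ (Fin p)) i ^ 2 = 1 := by
  have h : ‖(x : EuclideanSpace ℝ (Fin p))‖ = 1 := by simp
  rw [← EuclideanSpace.real_norm_sq_eq, h, one_pow]

theorem integral_coord_four (hp : 2 ≤ p) (i j k l : Fin p) :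
    ∫ x : USphere p, (x : EuclideanSpace ℝ (Fin p)) i * (x : EuclideanSpace ℝ (Fin p)) j *
        ((x : EuclideanSpace ℝ (Fin p)) k * (x : EuclideanSpace ℝ (Fin p)) l)
        ∂(uniformSphere p) =
      ((if i = j then 1 else 0) * (if k = l then 1 else 0) +
        (if i = k then 1 else 0) * (if j = l then 1 else 0) +
        (if i = l then 1 else 0) * (if j = k then 1 else 0)) / ((p : ℝ) * (p + 2)) := by
  obtain ⟨K, hK⟩ := exists_integral_inner_pow_four hp
  have hform (i j k l : Fin p) := integral_inner_mul_inner_four hp hK (EuclideanSpace.single i 1)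
    (EuclideanSpace.single j 1) (EuclideanSpace.single k 1) (EuclideanSpace.single l 1)
  simp only [EuclideanSpace.inner_single_right, one_mul,
    RCLike.conj_to_real, PiLp.single_apply] at hform
  have := isProbabilityMeasure_uniformSphere hp
  -- Integrating `(∑ x_i²)² = 1` determines `K`, so no spherical integral has to be evaluated.
  have hone : K * ((p : ℝ) * (p + 2)) = 1 := by
    have h1 : ∫ x : USphere p, (∑ i, (x : EuclideanSpace ℝ (Fin p)) i ^ 2) *
        (∑ i, (x : EuclideanSpace ℝ (Fin p)) i ^ 2) ∂(uniformSphere p) = 1 := by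
      simp [USphere.sum_sq]
    simp only [Finset.sum_mul_sum, sq] at h1
    have hsum : ∀ i, ∫ x : USphere p, ∑ j, (x : EuclideanSpace ℝ (Fin p)) i *
        (x : EuclideanSpace ℝ (Fin p)) i * ((x : EuclideanSpace ℝ (Fin p)) j *
          (x : EuclideanSpace ℝ (Fin p)) j) ∂(uniformSphere p) = K * (p + 2) := by
      intro i
      rw [integral_finsetSum _ fun j _ => integrable_of_continuous_uniformSphere hp (by fun_prop)]
      simp only [hform]
      rw [← Finset.mul_sum]
      congr 1
      simp [Finset.sum_add_distrib]
      ring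
    rw [integral_finsetSum _ fun i _ => integrable_of_continuous_uniformSphere hp (by fun_prop)]
      at h1
    simp only [hsum, Finset.sum_const, Finset.card_univ, Fintype.card_fin, nsmul_eq_mul] at h1
    rw [← h1]
    ring
  have hp0 : (0 : ℝ) < p := by positivity
  have hsw (a b : Fin p) : (if a = b then (1 : ℝ) else 0) = if b = a then 1 else 0 := by
    simp only [eq_comm]
  rw [hform, eq_div_iff (by positivity), hsw j i, hsw l k, hsw k i, hsw l j, hsw l i, hsw k j]
  linear_combination ((if i = j then 1 else 0) * (if k = l then 1 else 0) +
        (if i = k then 1 else 0) * (if j = l then 1 else 0) +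
        (if i = l then 1 else 0) * (if j = k then 1 else 0) : ℝ) * hone

theorem integral_coord_two (hp : 2 ≤ p) (i j : Fin p) :
    ∫ x : USphere p, (x : EuclideanSpace ℝ (Fin p)) i * (x : EuclideanSpace ℝ (Fin p)) j
        ∂(uniformSphere p) = (if i = j then 1 else 0) / (p : ℝ) := by
  have h (x : USphere p) : (x : EuclideanSpace ℝ (Fin p)) i * (x : EuclideanSpace ℝ (Fin p)) j =
      ∑ k, (x : EuclideanSpace ℝ (Fin p)) i * (x : EuclideanSpace ℝ (Fin p)) j *
        ((x : EuclideanSpace ℝ (Fin p)) k * (x : EuclideanSpace ℝ (Fin p)) k) := by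
    rw [← Finset.mul_sum]
    simp only [← sq, USphere.sum_sq, mul_one]
  rw [integral_congr_ae (.of_forall h),
    integral_finsetSum _ fun i _ => integrable_of_continuous_uniformSphere hp (by fun_prop)]
  simp only [integral_coord_four hp]
  have hp0 : (0 : ℝ) < p := by positivity
  rw [← Finset.sum_div, div_eq_div_iff (by positivity) (by positivity)]
  by_cases hij : i = j
  · subst hij
    simp [Finset.sum_add_distrib]
    ring
  · simp [hij, Finset.sum_add_distrib]

/-- The rank one matrix `x x'` as a vector indexed by pairs. -/
noncomputable def outerSelf (x : USphere p) : EuclideanSpace ℝ (Fin p × Fin p) :=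
  WithLp.toLp 2 fun ij =>
    (x : EuclideanSpace ℝ (Fin p)) ij.1 * (x : EuclideanSpace ℝ (Fin p)) ij.2

theorem continuous_outerSelf : Continuous (outerSelf (p := p)) := by
  unfold outerSelf
  fun_prop

theorem inner_outerSelf (A : EuclideanSpace ℝ (Fin p × Fin p)) (x : USphere p) :
    ⟪A, outerSelf x⟫ = ∑ i, ∑ j, A (i, j) *
      ((x : EuclideanSpace ℝ (Fin p)) i * (x : EuclideanSpace ℝ (Fin p)) j) := by
  rw [PiLp.inner_apply, Fintype.sum_prod_type]
  simp [outerSelf, mul_comm]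

theorem integral_inner_outerSelf (hp : 2 ≤ p) (A : EuclideanSpace ℝ (Fin p × Fin p)) :
    ∫ x, ⟪A, outerSelf x⟫ ∂(uniformSphere p) = (∑ i, A (i, i)) / p := by
  simp only [inner_outerSelf]
  rw [integral_finsetSum _ fun i _ => integrable_of_continuous_uniformSphere hp (by fun_prop)]
  rw [Finset.sum_div]
  refine Finset.sum_congr rfl fun i _ => ?_
  rw [integral_finsetSum _ fun i _ => integrable_of_continuous_uniformSphere hp (by fun_prop)]
  simp [integral_const_mul, integral_coord_two hp, div_eq_mul_inv]

/-- Of the three pairings in the fourth moment, one contributes `tr A · tr B = 0`; the other two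
agree by symmetry of `B`, whence the factor 2. -/
theorem integral_inner_outerSelf_mul (hp : 2 ≤ p) (A B : EuclideanSpace ℝ (Fin p × Fin p))
    (hA : ∑ i, A (i, i) = 0) (hB : ∀ i j, B (i, j) = B (j, i)) :
    ∫ x, ⟪A, outerSelf x⟫ * ⟪B, outerSelf x⟫ ∂(uniformSphere p) =
      2 * ⟪A, B⟫ / ((p : ℝ) * (p + 2)) := by
  have key (i j : Fin p) : ∫ x : USphere p, A (i, j) * ((x : EuclideanSpace ℝ (Fin p)) i *
      (x : EuclideanSpace ℝ (Fin p)) j) * ⟪B, outerSelf x⟫ ∂(uniformSphere p) =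
      ((if i = j then A (i, j) * ∑ k, B (k, k) else 0) + 2 * (A (i, j) * B (i, j))) /
        ((p : ℝ) * (p + 2)) := by
    have h (x : USphere p) : A (i, j) * ((x : EuclideanSpace ℝ (Fin p)) i *
      (x : EuclideanSpace ℝ (Fin p)) j) * ⟪B, outerSelf x⟫ = ∑ k, ∑ l, A (i, j) * B (k, l) *
      ((x : EuclideanSpace ℝ (Fin p)) i * (x : EuclideanSpace ℝ (Fin p)) j *
        ((x : EuclideanSpace ℝ (Fin p)) k * (x : EuclideanSpace ℝ (Fin p)) l)) := by
      rw [inner_outerSelf]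
      simp only [Finset.mul_sum]
      refine Finset.sum_congr rfl fun k _ => Finset.sum_congr rfl fun l _ => ?_
      ring
    rw [integral_congr_ae (.of_forall h),
      integral_finsetSum _ fun i _ => integrable_of_continuous_uniformSphere hp (by fun_prop)]
    have h2 (k : Fin p) : ∫ x : USphere p, ∑ l, A (i, j) * B (k, l) *
      ((x : EuclideanSpace ℝ (Fin p)) i * (x : EuclideanSpace ℝ (Fin p)) j *
        ((x : EuclideanSpace ℝ (Fin p)) k * (x : EuclideanSpace ℝ (Fin p)) l)) ∂(uniformSphere p) =
        ((if i = j then A (i, j) * B (k, k) else 0) + (if i = k then A (i, j) * B (k, j) else 0) +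
          (if j = k then A (i, j) * B (k, i) else 0)) / ((p : ℝ) * (p + 2)) := by
      rw [integral_finsetSum _ fun i _ => integrable_of_continuous_uniformSphere hp (by fun_prop)]
      simp only [integral_const_mul, integral_coord_four hp, ← mul_div_assoc]
      rw [← Finset.sum_div]
      congr 1
      simp [mul_add, Finset.sum_add_distrib]
    rw [Finset.sum_congr rfl fun k _ => h2 k, ← Finset.sum_div]
    congr 1
    rw [Finset.sum_add_distrib, Finset.sum_add_distrib, Finset.sum_ite_eq, Finset.sum_ite_eq,
      hB j i]
    simp only [Finset.mem_univ, if_true]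
    split_ifs
    · rw [Finset.mul_sum]
      ring
    · rw [Finset.sum_const_zero]
      ring
  have h (x : USphere p) : ⟪A, outerSelf x⟫ * ⟪B, outerSelf x⟫ = ∑ i, ∑ j, A (i, j) *
      ((x : EuclideanSpace ℝ (Fin p)) i * (x : EuclideanSpace ℝ (Fin p)) j) * ⟪B, outerSelf x⟫ := by
    rw [inner_outerSelf A, Finset.sum_mul]
    simp only [Finset.sum_mul]
  have hc := continuous_outerSelf (p := p)
  rw [integral_congr_ae (.of_forall h),
    integral_finsetSum _ fun i _ => integrable_of_continuous_uniformSphere hp (by fun_prop)]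
  have h2 (i : Fin p) : ∫ x : USphere p, ∑ j, A (i, j) * ((x : EuclideanSpace ℝ (Fin p)) i *
      (x : EuclideanSpace ℝ (Fin p)) j) * ⟪B, outerSelf x⟫ ∂(uniformSphere p) =
      (A (i, i) * ∑ k, B (k, k) + 2 * ∑ j, A (i, j) * B (i, j)) / ((p : ℝ) * (p + 2)) := by
    rw [integral_finsetSum _ fun i _ => integrable_of_continuous_uniformSphere hp (by fun_prop)]
    simp only [key]
    rw [← Finset.sum_div]
    simp [Finset.sum_add_distrib, ← Finset.mul_sum]
  rw [Finset.sum_congr rfl fun i _ => h2 i, ← Finset.sum_div, Finset.sum_add_distrib,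
    ← Finset.sum_mul, hA, ← Finset.mul_sum, PiLp.inner_apply, Fintype.sum_prod_type]
  simp [mul_comm]

end Moments

/-! ### Expansion of the characteristic function under a vanishing tilt -/

section TiltedExpansion

/-- A bound valid for all real `z`: it supplies the dominating function for the quadratic term. -/
theorem norm_cexp_mul_I_sub_one_sub_le (z : ℝ) :
    ‖Complex.exp (z * Complex.I) - 1 - z * Complex.I‖ ≤ 2 * z ^ 2 := by
  have hz : ‖(z : ℂ) * Complex.I‖ = |z| := by simp
  rcases le_total |z| 1 with h | h
  · refine (Complex.norm_exp_sub_one_sub_id_le (hz.trans_le h)).trans ?_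
    rw [hz, sq_abs]
    linarith [sq_nonneg z]
  · have h1 : ‖Complex.exp (z * Complex.I) - 1‖ ≤ |z| := by
      rw [mul_comm]
      exact Real.norm_exp_I_mul_ofReal_sub_one_le
    have h2 := norm_sub_le (Complex.exp (z * Complex.I) - 1) (z * Complex.I)
    rw [hz] at h2
    rw [← sq_abs]
    nlinarith

theorem tendsto_nat_mul_cexp_sub_one_sub (u : ℝ) :
    Tendsto (fun n : ℕ => (n : ℂ) * (Complex.exp (((u / √n : ℝ) : ℂ) * Complex.I) - 1 -
      ((u / √n : ℝ) : ℂ) * Complex.I)) atTop (𝓝 (-(u : ℂ) ^ 2 / 2)) := by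
  rw [tendsto_iff_norm_sub_tendsto_zero]
  have h0 : Tendsto (fun n : ℕ => |u| ^ 3 * Real.exp |u| * (√n)⁻¹) atTop (𝓝 0) := by
    rw [← mul_zero (|u| ^ 3 * Real.exp |u|)]
    exact (tendsto_inv_atTop_zero.comp
      (Real.tendsto_sqrt_atTop.comp tendsto_natCast_atTop_atTop)).const_mul _
  refine squeeze_zero' (.of_forall fun _ => norm_nonneg _) ?_ h0
  filter_upwards [eventually_gt_atTop 0] with n hn
  have hs : 1 ≤ √(n : ℝ) := Real.one_le_sqrt.2 (by exact_mod_cast hn)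
  have hss : √(n : ℝ) ^ 2 = n := Real.sq_sqrt (by positivity)
  have hssC : (√(n : ℝ) : ℂ) ^ 2 = n := by exact_mod_cast hss
  have hs0 : (√(n : ℝ) : ℂ) ≠ 0 := by
    norm_cast
    positivity
  have hb := Complex.norm_exp_sub_sum_le_norm_mul_exp (((u / √n : ℝ) : ℂ) * Complex.I) 3
  have hn : ‖((u / √n : ℝ) : ℂ) * Complex.I‖ = |u| / √n := by
    rw [norm_mul, Complex.norm_I, mul_one, Complex.norm_real, Real.norm_eq_abs, abs_div,
      abs_of_nonneg (Real.sqrt_nonneg _)]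
  have heq : (n : ℂ) * (Complex.exp (((u / √n : ℝ) : ℂ) * Complex.I) - 1 -
      ((u / √n : ℝ) : ℂ) * Complex.I) - (-(u : ℂ) ^ 2 / 2) =
      n * (Complex.exp (((u / √n : ℝ) : ℂ) * Complex.I) -
        ∑ m ∈ Finset.range 3, (((u / √n : ℝ) : ℂ) * Complex.I) ^ m / (m.factorial : ℂ)) := by
    simp only [Finset.sum_range_succ, Finset.sum_range_zero, Nat.factorial, mul_pow, Complex.I_sq]
    push_cast
    rw [← hssC]
    field_simp
    ring
  rw [heq, norm_mul, Complex.norm_natCast]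
  rw [hn] at hb
  calc (n : ℝ) * _ ≤ n * ((|u| / √n) ^ 3 * Real.exp |u|) := by
        gcongr
        refine hb.trans ?_
        gcongr
        exact div_le_self (abs_nonneg _) hs
    _ = √n ^ 2 * ((|u| / √n) ^ 3 * Real.exp |u|) := by rw [hss]
    _ = |u| ^ 3 * Real.exp |u| * (√n)⁻¹ := by field_simp

variable {S : Type*} [MeasurableSpace S] {ν : Measure S} [IsProbabilityMeasure ν]
  {f : ℝ → ℝ} {κ : ℕ → ℝ} {c : ℝ} {u h : S → ℝ} {C : ℝ}

theorem IsAngularFunction.hasDerivAt (hf : IsAngularFunction f) : HasDerivAt f 1 0 := by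
  have h := hf.differentiable_near.self_of_nhds.hasDerivAt
  rwa [hf.deriv_zero] at h

theorem tendsto_zero_of_sqrt_mul (hκ : Tendsto (fun n : ℕ => √n * κ n) atTop (𝓝 c)) :
    Tendsto κ atTop (𝓝 0) := by
  have h0 : Tendsto (fun n : ℕ => (√n)⁻¹) atTop (𝓝 0) :=
    tendsto_inv_atTop_zero.comp (Real.tendsto_sqrt_atTop.comp tendsto_natCast_atTop_atTop)
  have := h0.mul hκ
  rw [zero_mul] at this
  refine this.congr' ?_
  filter_upwards [eventually_gt_atTop 0] with n hn
  have : √(n : ℝ) ≠ 0 := by positivity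
  field_simp

theorem IsAngularFunction.eventually_abs_sub_one_le (hf : IsAngularFunction f) :
    ∀ᶠ y in 𝓝 (0 : ℝ), |f y - 1| ≤ 2 * |y| := by
  have h := hf.hasDerivAt.isLittleO
  have h2 := h.def (c := 1) one_pos
  filter_upwards [h2] with y hy
  simp only [hf.map_zero, sub_zero, smul_eq_mul, mul_one, one_mul, Real.norm_eq_abs] at hy
  calc |f y - 1| = |(f y - 1 - y) + y| := by ring_nf
    _ ≤ |f y - 1 - y| + |y| := abs_add_le _ _
    _ ≤ 2 * |y| := by linarith

/-- Uniformity in `t` is what dominated convergence needs, with `t` standing for `(x'θ)²`. -/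
theorem IsAngularFunction.eventually_abs_comp_sub_one_le (hf : IsAngularFunction f)
    (hκ : Tendsto κ atTop (𝓝 0)) :
    ∀ᶠ n in atTop, ∀ t ∈ Set.Icc (0 : ℝ) 1, |f (κ n * t) - 1| ≤ 2 * |κ n| := by
  obtain ⟨ε, hε, H⟩ := Metric.eventually_nhds_iff.1 hf.eventually_abs_sub_one_le
  filter_upwards [Metric.tendsto_nhds.1 hκ ε hε] with n hn t ht
  have hle : |κ n * t| ≤ |κ n| := by
    rw [abs_mul, abs_of_nonneg ht.1]
    exact mul_le_of_le_one_right (abs_nonneg _) ht.2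
  refine (H (y := κ n * t) ?_).trans (by linarith)
  simp only [Real.dist_eq, sub_zero] at hn ⊢
  linarith

theorem IsAngularFunction.tendsto_sqrt_mul_sub_one (hf : IsAngularFunction f)
    (hκ : Tendsto (fun n : ℕ => √n * κ n) atTop (𝓝 c)) (t : ℝ) :
    Tendsto (fun n : ℕ => √n * (f (κ n * t) - 1)) atTop (𝓝 (c * t)) := by
  have h0 : Tendsto (fun n => κ n * t) atTop (𝓝 0) := by
    simpa using (tendsto_zero_of_sqrt_mul hκ).mul_const t
  have h1 : Tendsto (fun n : ℕ => √n * κ n * t) atTop (𝓝 (c * t)) := hκ.mul_const t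
  have ho := hf.hasDerivAt.isLittleO.comp_tendsto h0
  have ho2 : (fun n : ℕ => √n * (f (κ n * t) - 1 - κ n * t)) =o[atTop]
      fun n : ℕ => √n * (κ n * t) := by
    refine (Asymptotics.isBigO_refl _ _).mul_isLittleO ?_
    simpa [Function.comp_def, hf.map_zero] using ho
  have h2 : Tendsto (fun n : ℕ => √n * (f (κ n * t) - 1 - κ n * t)) atTop (𝓝 0) := by
    have hO : (fun n : ℕ => √n * (κ n * t)) =O[atTop] fun _ => (1 : ℝ) := by
      refine (h1.isBigO_one ℝ).congr_left fun n => by ring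
    exact (Asymptotics.isLittleO_one_iff ℝ).1 (ho2.trans_isBigO hO)
  have h3 := h2.add h1
  rw [zero_add] at h3
  exact h3.congr fun n => by ring

theorem IsAngularFunction.tendsto_comp (hf : IsAngularFunction f)
    (hκ : Tendsto κ atTop (𝓝 0)) (t : ℝ) :
    Tendsto (fun n : ℕ => f (κ n * t)) atTop (𝓝 1) := by
  have h0 : Tendsto (fun n => κ n * t) atTop (𝓝 0) := by simpa using hκ.mul_const t
  have := hf.hasDerivAt.continuousAt.tendsto.comp h0
  rwa [hf.map_zero] at this

theorem tendsto_integral_comp_one (hf : IsAngularFunction f) (hκ : Tendsto κ atTop (𝓝 0))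
    (hh : Measurable h) (hh01 : ∀ x, h x ∈ Set.Icc (0 : ℝ) 1) :
    Tendsto (fun n => ∫ x, f (κ n * h x) ∂ν) atTop (𝓝 1) := by
  have key : Tendsto (fun n => ∫ x, f (κ n * h x) ∂ν) atTop (𝓝 (∫ _, (1 : ℝ) ∂ν)) := by
    refine tendsto_integral_filter_of_dominated_convergence (fun _ => 3) ?_ ?_
      (integrable_const _) (.of_forall fun x => hf.tendsto_comp hκ (h x))
    · exact .of_forall fun n =>
        (hf.mono.measurable.comp (hh.const_mul _)).aestronglyMeasurable
    · filter_upwards [hf.eventually_abs_comp_sub_one_le hκ,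
        hκ.eventually (Metric.ball_mem_nhds 0 one_pos)]
        with n hn hn1
      refine .of_forall fun x => ?_
      have h1 := hn _ (hh01 x)
      simp only [Real.dist_eq, sub_zero] at hn1
      rw [Real.norm_eq_abs]
      rw [abs_le] at *
      rw [abs_lt] at hn1
      have : |κ n| < 1 := abs_lt.2 hn1
      constructor <;> linarith
  simpa using key

/-- Write `e^{iz} - 1 = (e^{iz} - 1 - iz) + iz` with `z = u/√n`. In the first piece `n` compensates
`z²` and the weight tends to 1. In the second only `√n` remains, and it is absorbed by `f(κ_n h) - 1
≈ κ_n h` because `u` is centered. Both limits are by dominated convergence. -/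
theorem tendsto_nat_mul_integral_tilted (hf : IsAngularFunction f)
    (hκ : Tendsto (fun n : ℕ => √n * κ n) atTop (𝓝 c))
    (hu : Measurable u) (huC : ∀ x, |u x| ≤ C) (hu0 : ∫ x, u x ∂ν = 0)
    (hh : Measurable h) (hh01 : ∀ x, h x ∈ Set.Icc (0 : ℝ) 1) :
    Tendsto (fun n : ℕ => (n : ℂ) *
      ∫ x, (Complex.exp (((u x / √n : ℝ) : ℂ) * Complex.I) - 1) * (f (κ n * h x) : ℂ) ∂ν) atTop
      (𝓝 ((c * ∫ x, u x * h x ∂ν : ℝ) * Complex.I - (∫ x, u x ^ 2 ∂ν : ℝ) / 2)) := by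
  have hκ0 := tendsto_zero_of_sqrt_mul hκ
  have hev := hf.eventually_abs_comp_sub_one_le hκ0
  have hmf (n : ℕ) : Measurable fun x => f (κ n * h x) :=
    hf.mono.measurable.comp (hh.const_mul _)
  have hbd : ∀ᶠ n in atTop, ∀ x, |f (κ n * h x)| ≤ 3 := by
    filter_upwards [hev, hκ0.eventually (Metric.ball_mem_nhds 0 one_pos)] with n hn hn1 x
    have h1 := hn _ (hh01 x)
    simp only [Real.dist_eq, sub_zero] at hn1
    calc |f (κ n * h x)| = |(f (κ n * h x) - 1) + 1| := by ring_nf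
      _ ≤ |f (κ n * h x) - 1| + |1| := abs_add_le _ _
      _ ≤ 3 := by rw [abs_one]; linarith
  have hA : Tendsto (fun n : ℕ => ∫ x, (n : ℂ) * (Complex.exp (((u x / √n : ℝ) : ℂ) * Complex.I) -
      1 - ((u x / √n : ℝ) : ℂ) * Complex.I) * (f (κ n * h x) : ℂ) ∂ν) atTop
      (𝓝 (∫ x, -(u x : ℂ) ^ 2 / 2 * ((1 : ℝ) : ℂ) ∂ν)) := by
    refine tendsto_integral_filter_of_dominated_convergence (fun _ => 2 * C ^ 2 * 3) ?_ ?_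
      (integrable_const _) (.of_forall fun x => ?_)
    · refine .of_forall fun n => (Measurable.mul (by fun_prop)
        (Complex.measurable_ofReal.comp (hmf n))).aestronglyMeasurable
    · filter_upwards [hbd, eventually_gt_atTop 0] with n hn hn0
      refine .of_forall fun x => ?_
      rw [norm_mul, norm_mul, Complex.norm_real, Complex.norm_natCast, Real.norm_eq_abs]
      refine mul_le_mul ?_ (hn x) (abs_nonneg _) (by positivity)
      calc (n : ℝ) * _ ≤ n * (2 * (u x / √n) ^ 2) := by
            gcongr
            exact norm_cexp_mul_I_sub_one_sub_le _
        _ = 2 * |u x| ^ 2 := by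
            rw [div_pow, Real.sq_sqrt (by positivity), sq_abs]
            field_simp
        _ ≤ 2 * C ^ 2 := by
            gcongr
            exact huC x
    · refine (tendsto_nat_mul_cexp_sub_one_sub (u x)).mul ?_
      exact (Complex.continuous_ofReal.tendsto _).comp (hf.tendsto_comp hκ0 (h x))
  have hB : Tendsto (fun n : ℕ => ∫ x, u x * (√n * (f (κ n * h x) - 1)) ∂ν) atTop
      (𝓝 (∫ x, u x * (c * h x) ∂ν)) := by
    refine tendsto_integral_filter_of_dominated_convergence (fun _ => C * (2 * (|c| + 1))) ?_ ?_
      (integrable_const _) (.of_forall fun x =>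
        (hf.tendsto_sqrt_mul_sub_one hκ (h x)).const_mul _)
    · refine .of_forall fun n => (hu.mul (((hmf n).sub_const 1).const_mul _)).aestronglyMeasurable
    · have hlt : ∀ᶠ n : ℕ in atTop, |√n * κ n| < |c| + 1 :=
        hκ.abs.eventually_lt_const (by linarith)
      filter_upwards [hev, hlt] with n hn hn1
      refine .of_forall fun x => ?_
      rw [norm_mul, norm_mul, Real.norm_eq_abs, Real.norm_eq_abs, Real.norm_eq_abs]
      refine mul_le_mul (huC x) ?_ (by positivity) ((abs_nonneg _).trans (huC x))
      calc |√(n : ℝ)| * |f (κ n * h x) - 1| ≤ |√(n : ℝ)| * (2 * |κ n|) := by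
            gcongr
            exact hn _ (hh01 x)
        _ = 2 * |√n * κ n| := by rw [abs_mul]; ring
        _ ≤ 2 * (|c| + 1) := by linarith
  have hlim : (∫ x, -(u x : ℂ) ^ 2 / 2 * ((1 : ℝ) : ℂ) ∂ν) +
      ((∫ x, u x * (c * h x) ∂ν : ℝ) : ℂ) * Complex.I =
      ((c * ∫ x, u x * h x ∂ν : ℝ) * Complex.I - (∫ x, u x ^ 2 ∂ν : ℝ) / 2) := by
    have h1 : (∫ x, -(u x : ℂ) ^ 2 / 2 * ((1 : ℝ) : ℂ) ∂ν) =
        ((-(∫ x, u x ^ 2 ∂ν) / 2 : ℝ) : ℂ) := by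
      rw [← integral_neg, ← integral_div, ← integral_complex_ofReal]
      refine integral_congr_ae (.of_forall fun x => ?_)
      push_cast
      ring
    have h2 : (∫ x, u x * (c * h x) ∂ν) = c * ∫ x, u x * h x ∂ν := by
      rw [← integral_const_mul]
      refine integral_congr_ae (.of_forall fun x => ?_)
      simp only
      ring
    rw [h1, h2]
    push_cast
    ring
  rw [← hlim]
  refine (hA.add (((Complex.continuous_ofReal.tendsto _).comp hB).mul_const Complex.I)).congr' ?_
  filter_upwards [hbd, eventually_gt_atTop 0] with n hn hn0
  have hui : Integrable u ν := Integrable.of_bound hu.aestronglyMeasurable C (.of_forall huC)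
  have hfu : Integrable (fun x => u x * f (κ n * h x)) ν := by
    refine Integrable.of_bound (hu.mul (hmf n)).aestronglyMeasurable (C * 3)
      (.of_forall fun x => ?_)
    rw [norm_mul]
    exact mul_le_mul (huC x) (hn x) (abs_nonneg _) ((abs_nonneg _).trans (huC x))
  -- Centering of `u` allows the constant 1 to be subtracted from the weight at no cost.
  have hB2 : ∫ x, u x * (√n * (f (κ n * h x) - 1)) ∂ν = ∫ x, √n * (u x * f (κ n * h x)) ∂ν := by
    have h1 (x : S) : u x * (√n * (f (κ n * h x) - 1)) =
        √n * (u x * f (κ n * h x)) - √n * u x := by ring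
    simp only [h1]
    rw [integral_sub (hfu.const_mul _) (hui.const_mul _), integral_const_mul √n u, hu0]
    simp
  have hs : (√(n : ℝ) : ℂ) ≠ 0 := by
    norm_cast
    positivity
  have hss : (√(n : ℝ) : ℂ) ^ 2 = n := by
    norm_cast
    exact Real.sq_sqrt (by positivity)
  simp only [Function.comp_def]
  rw [hB2, ← integral_complex_ofReal, ← integral_mul_const, ← integral_add, ← integral_const_mul]
  · refine integral_congr_ae (.of_forall fun x => ?_)
    simp only
    push_cast
    rw [← hss]
    field_simp
    ring
  · refine Integrable.of_bound (C := n * (2 * C ^ 2) * 3) ?_ (.of_forall fun x => ?_)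
    · refine (Measurable.mul (by fun_prop)
        (Complex.measurable_ofReal.comp (hmf n))).aestronglyMeasurable
    · rw [norm_mul, norm_mul, Complex.norm_real, Complex.norm_natCast, Real.norm_eq_abs]
      refine mul_le_mul ?_ (hn x) (abs_nonneg _) (by positivity)
      gcongr
      refine (norm_cexp_mul_I_sub_one_sub_le _).trans ?_
      rw [← sq_abs]
      gcongr
      rw [abs_div]
      refine (div_le_self (abs_nonneg _) ?_).trans (huC x)
      rw [abs_of_nonneg (by positivity)]
      exact Real.one_le_sqrt.2 (by exact_mod_cast hn0)
  · exact (hfu.const_mul _).ofReal.mul_const _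

end TiltedExpansion

/-! ### Traceless symmetric matrices and the Bingham statistic as a squared norm -/

section TracelessSymmetric

variable {p : ℕ}

/-- The traceless symmetric `p × p` matrices, as vectors indexed by pairs with the Frobenius
inner product. -/
def tracelessSymm (p : ℕ) : Submodule ℝ (EuclideanSpace ℝ (Fin p × Fin p)) where
  carrier := {A | (∀ i j, A (i, j) = A (j, i)) ∧ ∑ i, A (i, i) = 0}
  add_mem' := by
    rintro A B ⟨hA, hA'⟩ ⟨hB, hB'⟩
    refine ⟨fun i j => ?_, ?_⟩
    · simp [hA i j, hB i j]
    · simp [Finset.sum_add_distrib, hA', hB']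
  zero_mem' := by simp
  smul_mem' := by
    rintro c A ⟨hA, hA'⟩
    refine ⟨fun i j => ?_, ?_⟩
    · simp [hA i j]
    · simp [← Finset.mul_sum, hA']

/-- The sum of the diagonal entries of a function on unordered pairs. -/
def diagSum (p : ℕ) : (Sym2 (Fin p) → ℝ) →ₗ[ℝ] ℝ where
  toFun g := ∑ i, g s(i, i)
  map_add' g h := by simp [Finset.sum_add_distrib]
  map_smul' c g := by simp [Finset.mul_sum]

/-- Symmetric matrices are functions on unordered pairs. -/
noncomputable def tracelessSymmEquiv (p : ℕ) : tracelessSymm p ≃ₗ[ℝ] (diagSum p).ker where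
  toFun A := ⟨fun z => Sym2.lift ⟨fun i j => (A : EuclideanSpace ℝ (Fin p × Fin p)) (i, j),
    A.2.1⟩ z, A.2.2⟩
  map_add' A B := by
    ext z
    induction z with | h i j => rfl
  map_smul' c A := by
    ext z
    induction z with | h i j => rfl
  invFun g := ⟨WithLp.toLp 2 fun ij => g.1 s(ij.1, ij.2),
    ⟨fun i j => by simp [Sym2.eq_swap], by
      have := g.2
      simpa [diagSum] using this⟩⟩
  left_inv A := by
    ext ij
    rfl
  right_inv g := by
    ext z
    induction z with | h i j => rfl

/-- The space is the kernel of a nonzero functional on functions of unordered pairs, of which there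
are `p(p+1)/2`. -/
theorem finrank_tracelessSymm (hp : 1 ≤ p) :
    Module.finrank ℝ (tracelessSymm p) = binghamDof p := by
  have hne : diagSum p ≠ 0 := by
    intro h
    have := DFunLike.congr_fun h fun _ => 1
    simp [diagSum] at this
    omega
  have h := Module.Dual.finrank_ker_add_one_of_ne_zero hne
  rw [Module.finrank_fintype_fun_eq_card, Sym2.card, Fintype.card_fin, Nat.choose_two_right] at h
  rw [(tracelessSymmEquiv p).finrank_eq, binghamDof]
  have : (p + 1) * (p + 1 - 1) = p * (p + 1) := by
    simp [mul_comm]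
  rw [this] at h
  omega

local notation "⟪" x ", " y "⟫" => inner ℝ x y

/-- The traceless part `x x' - I / p` of `x x'`. -/
noncomputable def centeredOuter (x : USphere p) : EuclideanSpace ℝ (Fin p × Fin p) :=
  outerSelf x - WithLp.toLp 2 fun ij => if ij.1 = ij.2 then (p : ℝ)⁻¹ else 0

theorem centeredOuter_mem (hp : 1 ≤ p) (x : USphere p) : centeredOuter x ∈ tracelessSymm p := by
  have hp0 : (p : ℝ) ≠ 0 := by positivity
  refine ⟨fun i j => ?_, ?_⟩
  · simp [centeredOuter, outerSelf, mul_comm, eq_comm]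
  · simp [centeredOuter, outerSelf, ← sq, USphere.sum_sq, hp0]

theorem inner_centeredOuter {A : EuclideanSpace ℝ (Fin p × Fin p)} (hA : A ∈ tracelessSymm p)
    (x : USphere p) : ⟪A, centeredOuter x⟫ = ⟪A, outerSelf x⟫ := by
  rw [centeredOuter, inner_sub_right, sub_eq_self, PiLp.inner_apply, Fintype.sum_prod_type]
  simp [← Finset.mul_sum, hA.2]

theorem norm_centeredOuter_sq (hp : 1 ≤ p) (x : USphere p) :
    ‖centeredOuter x‖ ^ 2 = 1 - 1 / (p : ℝ) := by
  have hp0 : (p : ℝ) ≠ 0 := by positivity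
  have h1 : ∑ i, ∑ j, ((x : EuclideanSpace ℝ (Fin p)) i * (x : EuclideanSpace ℝ (Fin p)) j) *
      ((x : EuclideanSpace ℝ (Fin p)) i * (x : EuclideanSpace ℝ (Fin p)) j) = 1 := by
    have h := Finset.sum_mul_sum Finset.univ Finset.univ
      (fun i => (x : EuclideanSpace ℝ (Fin p)) i ^ 2)
      (fun i => (x : EuclideanSpace ℝ (Fin p)) i ^ 2)
    rw [USphere.sum_sq, mul_one] at h
    refine Eq.trans ?_ h.symm
    refine Finset.sum_congr rfl fun i _ => Finset.sum_congr rfl fun j _ => by ring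
  rw [← real_inner_self_eq_norm_sq, inner_centeredOuter (centeredOuter_mem hp x),
    real_inner_comm, centeredOuter, inner_sub_right, inner_outerSelf]
  simp only [outerSelf, h1, PiLp.inner_apply, Fintype.sum_prod_type]
  simp [← Finset.mul_sum, ← sq, USphere.sum_sq]

theorem exists_orthonormalBasis_tracelessSymm (hp : 2 ≤ p) (e : tracelessSymm p) (he : ‖e‖ = 1)
    (i₀ : Fin (binghamDof p)) :
    ∃ b : OrthonormalBasis (Fin (binghamDof p)) ℝ (tracelessSymm p), b i₀ = e := by
  have hcard : Module.finrank ℝ (tracelessSymm p) = Fintype.card (Fin (binghamDof p)) := by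
    rw [finrank_tracelessSymm (by omega), Fintype.card_fin]
  obtain ⟨b, hb⟩ := Orthonormal.exists_orthonormalBasis_extension_of_card_eq hcard
    (v := fun _ => e) (s := {i₀}) (by
      refine ⟨fun i => he, fun i j hij => ?_⟩
      exact absurd (Subsingleton.elim i j) hij)
  exact ⟨b, hb i₀ rfl⟩

/-- The coordinates of `√(p (p + 2) / 2) (x x' - I / p)` in an orthonormal basis of the traceless
symmetric matrices. -/
noncomputable def outerCoord {ι : Type*} [Fintype ι] (b : OrthonormalBasis ι ℝ (tracelessSymm p))
    (x : USphere p) : EuclideanSpace ℝ ι :=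
  WithLp.toLp 2 fun i => √(p * (p + 2) / 2) *
    ⟪(b i : EuclideanSpace ℝ (Fin p × Fin p)), outerSelf x⟫

variable {ι : Type*} [Fintype ι] (b : OrthonormalBasis ι ℝ (tracelessSymm p))

theorem continuous_outerCoord : Continuous (outerCoord b) := by
  have := continuous_outerSelf (p := p)
  unfold outerCoord
  fun_prop

theorem outerCoord_eq (hp : 1 ≤ p) (x : USphere p) :
    outerCoord b x = √(p * (p + 2) / 2) • b.repr ⟨centeredOuter x, centeredOuter_mem hp x⟩ := by
  ext i
  simp only [outerCoord, PiLp.smul_apply, smul_eq_mul, b.repr_apply_apply, Submodule.coe_inner,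
    inner_centeredOuter (b i).2]

/-- Turns a linear form in the coordinates into a pairing of `xx'` with one traceless symmetric
matrix, to which the moment formulas apply. -/
theorem inner_outerCoord (t : EuclideanSpace ℝ ι) (x : USphere p) :
    ⟪outerCoord b x, t⟫ = √(p * (p + 2) / 2) *
      ⟪((b.repr.symm t : tracelessSymm p) : EuclideanSpace ℝ (Fin p × Fin p)), outerSelf x⟫ := by
  rw [← b.sum_repr (b.repr.symm t)]
  simp only [LinearIsometryEquiv.apply_symm_apply, Submodule.coe_sum, Submodule.coe_smul, sum_inner,
    PiLp.inner_apply, Finset.mul_sum, outerCoord]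
  refine Finset.sum_congr rfl fun i _ => ?_
  simp only [PiLp.smul_apply, smul_eq_mul, RCLike.inner_apply, conj_trivial]
  exact Finset.sum_congr rfl fun _ _ => by ring

/-- Coordinates in an orthonormal basis preserve the Frobenius norm, and `tr S = 1` gives `‖S -
I/p‖² = tr S² - 1/p`. -/
theorem binghamStat_eq (hp : 1 ≤ p) {n : ℕ} (x : Fin n → USphere p) :
    binghamStat x = ‖∑ i, (√(n : ℝ))⁻¹ • outerCoord b (x i)‖ ^ 2 := by
  rcases Nat.eq_zero_or_pos n with rfl | hn
  · simp [binghamStat]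
  have hp0 : (p : ℝ) ≠ 0 := by positivity
  have hn0 : (n : ℝ) ≠ 0 := by positivity
  have h1 : ∑ i, (√(n : ℝ))⁻¹ • outerCoord b (x i) = ((√(n : ℝ))⁻¹ * √(p * (p + 2) / 2)) •
      b.repr (∑ i, ⟨centeredOuter (x i), centeredOuter_mem hp (x i)⟩) := by
    simp only [outerCoord_eq b hp, smul_smul, ← Finset.smul_sum, map_sum]
  rw [h1, norm_smul, LinearIsometryEquiv.norm_map, mul_pow, norm_mul, mul_pow, Real.norm_eq_abs,
    Real.norm_eq_abs, sq_abs, sq_abs, inv_pow, Real.sq_sqrt (by positivity),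
    Real.sq_sqrt (by positivity), Submodule.coe_norm, Submodule.coe_sum, binghamStat]
  have h2 : ∑ i, centeredOuter (x i) = WithLp.toLp 2 fun ij : Fin p × Fin p =>
      (n : ℝ) * (sampleCov x ij.1 ij.2 - if ij.1 = ij.2 then (p : ℝ)⁻¹ else 0) := by
    ext ij
    simp only [centeredOuter, sampleCov, Finset.sum_sub_distrib, Matrix.smul_apply,
      Matrix.sum_apply, Matrix.vecMulVec_apply, WithLp.ofLp_sub, WithLp.ofLp_sum, outerSelf]
    simp [mul_sub, hn0]
  have htr : ∑ i, sampleCov x i i = 1 := by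
    simp only [sampleCov, Matrix.smul_apply, Matrix.sum_apply, Matrix.vecMulVec_apply, smul_eq_mul,
      ← Finset.mul_sum]
    rw [Finset.sum_comm]
    simp [← sq, USphere.sum_sq, hn0]
  have hsymm (i j : Fin p) : sampleCov x i j = sampleCov x j i := by
    simp only [sampleCov, Matrix.smul_apply, Matrix.sum_apply, Matrix.vecMulVec_apply, mul_comm]
  have h3 : (sampleCov x ^ 2).trace = ∑ i, ∑ j, sampleCov x i j ^ 2 := by
    simp only [Matrix.trace, Matrix.diag, sq, Matrix.mul_apply]
    refine Finset.sum_congr rfl fun i _ => Finset.sum_congr rfl fun j _ => ?_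
    rw [hsymm j i]
  have h4 : ∑ i, ∑ j, (sampleCov x i j - if i = j then (p : ℝ)⁻¹ else 0) ^ 2 =
      (∑ i, ∑ j, sampleCov x i j ^ 2) - 1 / p := by
    have h5 (i j : Fin p) : (sampleCov x i j - if i = j then (p : ℝ)⁻¹ else 0) ^ 2 =
        sampleCov x i j ^ 2 - (if i = j then 2 * (p : ℝ)⁻¹ * sampleCov x i j - (p : ℝ)⁻¹ ^ 2
          else 0) := by
      split_ifs <;> ring
    simp only [h5, Finset.sum_sub_distrib, Finset.sum_ite_eq, Finset.mem_univ, if_true,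
      ← Finset.mul_sum, htr, Finset.sum_const, Finset.card_univ, Fintype.card_fin, nsmul_eq_mul]
    field_simp
    ring
  rw [h2, EuclideanSpace.real_norm_sq_eq, Fintype.sum_prod_type, h3, ← h4]
  simp only [mul_pow, ← Finset.mul_sum]
  field_simp

theorem integral_inner_outerCoord (hp : 2 ≤ p) (t : EuclideanSpace ℝ ι) :
    ∫ x, ⟪outerCoord b x, t⟫ ∂(uniformSphere p) = 0 := by
  simp only [inner_outerCoord, integral_const_mul]
  rw [integral_inner_outerSelf hp, (b.repr.symm t).2.2]
  simp

/-- The scale `√(p(p+2)/2)` is the one that makes the covariance the identity. -/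
theorem integral_inner_outerCoord_sq (hp : 2 ≤ p) (t : EuclideanSpace ℝ ι) :
    ∫ x, ⟪outerCoord b x, t⟫ ^ 2 ∂(uniformSphere p) = ‖t‖ ^ 2 := by
  have hp0 : (p : ℝ) ≠ 0 := by positivity
  have hp2 : (p : ℝ) + 2 ≠ 0 := by positivity
  simp only [inner_outerCoord, mul_pow, integral_const_mul]
  simp only [sq ⟪_, _⟫]
  rw [integral_inner_outerSelf_mul hp _ _ (b.repr.symm t).2.2 (b.repr.symm t).2.1,
    ← Submodule.coe_inner, real_inner_self_eq_norm_sq, LinearIsometryEquiv.norm_map,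
    Real.sq_sqrt (by positivity)]
  field_simp

/-- The argument of the tilt is itself linear in `xx'`, so its covariance with the coordinates is
again a fourth moment. -/
theorem inner_sphere_sq (x θ : USphere p) :
    ⟪(x : EuclideanSpace ℝ (Fin p)), (θ : EuclideanSpace ℝ (Fin p))⟫ ^ 2 =
      ⟪outerSelf θ, outerSelf x⟫ := by
  rw [inner_outerSelf, PiLp.inner_apply, sq, Finset.sum_mul_sum]
  refine Finset.sum_congr rfl fun i _ => Finset.sum_congr rfl fun j _ => ?_
  simp [outerSelf]
  ring

theorem integral_inner_outerCoord_mul (hp : 2 ≤ p) (θ : USphere p) (t : EuclideanSpace ℝ ι) :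
    ∫ x, ⟪outerCoord b x, t⟫ *
        ⟪(x : EuclideanSpace ℝ (Fin p)), (θ : EuclideanSpace ℝ (Fin p))⟫ ^ 2 ∂(uniformSphere p) =
      √(p * (p + 2) / 2) * (2 / (p * (p + 2))) *
        ⟪((b.repr.symm t : tracelessSymm p) : EuclideanSpace ℝ (Fin p × Fin p)),
          centeredOuter θ⟫ := by
  simp only [inner_outerCoord, mul_assoc, integral_const_mul, inner_sphere_sq]
  rw [integral_inner_outerSelf_mul hp _ _ (b.repr.symm t).2.2 (fun i j => by
    simp [outerSelf, mul_comm]), inner_centeredOuter (b.repr.symm t).2]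
  ring

end TracelessSymmetric

/-! ### Noncentral chi-square law: Gaussian representation and absence of atoms -/

section NoncentralChiSq

/-- The Gaussian law on `ℝ^d` with identity covariance and mean `√δ e₀`. -/
noncomputable def shiftedGaussian (d : ℕ) (δ : ℝ) : Measure (EuclideanSpace ℝ (Fin d)) :=
  (Measure.pi (fun i : Fin d => gaussianReal (if (i : ℕ) = 0 then √δ else 0) 1)).map
    (WithLp.toLp 2)

instance (d : ℕ) (δ : ℝ) : IsProbabilityMeasure (shiftedGaussian d δ) :=
  Measure.isProbabilityMeasure_map (by fun_prop)

theorem map_norm_sq_shiftedGaussian (d : ℕ) (δ : ℝ) :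
    (shiftedGaussian d δ).map (fun z => ‖z‖ ^ 2) = noncentralChiSq d δ := by
  rw [shiftedGaussian, Measure.map_map (by fun_prop) (by fun_prop), noncentralChiSq]
  congr 1
  ext z
  simp [EuclideanSpace.real_norm_sq_eq]

theorem charFun_shiftedGaussian {d : ℕ} (δ : ℝ) (i₀ : Fin d) (hi₀ : (i₀ : ℕ) = 0)
    (t : EuclideanSpace ℝ (Fin d)) :
    charFun (shiftedGaussian d δ) t =
      Complex.exp ((√δ * t i₀ : ℝ) * Complex.I - (‖t‖ ^ 2 : ℝ) / 2) := by
  rw [shiftedGaussian, charFun_pi]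
  simp only [charFun_gaussianReal]
  rw [← Complex.exp_sum, Finset.sum_sub_distrib, EuclideanSpace.real_norm_sq_eq,
    Finset.sum_eq_single i₀]
  · simp [hi₀, Finset.sum_div]
    ring_nf
  · intro i _ hi
    have : (i : ℕ) ≠ 0 := fun h => hi (Fin.ext (h.trans hi₀.symm))
    simp [this]
  · simp

/-- By Fubini: once the other coordinates are fixed, the first is confined to at most two values, a
Gaussian null set. -/
theorem noncentralChiSq_singleton {d : ℕ} (hd : 0 < d) (δ q : ℝ) :
    noncentralChiSq d δ {q} = 0 := by
  obtain ⟨d, rfl⟩ : ∃ k, d = k + 1 := ⟨d - 1, by omega⟩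
  have hm : Measurable fun z : Fin (d + 1) → ℝ => ∑ i, z i ^ 2 := by fun_prop
  rw [noncentralChiSq, Measure.map_apply hm (measurableSet_singleton q)]
  set μ : Fin (d + 1) → Measure ℝ := fun i => gaussianReal (if (i : ℕ) = 0 then √δ else 0) 1
  have hmp := measurePreserving_piFinSuccAbove μ 0
  have hs : MeasurableSet {w : ℝ × (Fin d → ℝ) | w.1 ^ 2 + ∑ i, w.2 i ^ 2 = q} :=
    measurableSet_eq_fun (by fun_prop) (by fun_prop)
  have hpre : (fun z : Fin (d + 1) → ℝ => ∑ i, z i ^ 2) ⁻¹' {q} =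
      (MeasurableEquiv.piFinSuccAbove (fun _ => ℝ) 0) ⁻¹'
        {w : ℝ × (Fin d → ℝ) | w.1 ^ 2 + ∑ i, w.2 i ^ 2 = q} := by
    ext z
    simp [Fin.sum_univ_succ, MeasurableEquiv.piFinSuccAbove, Fin.insertNthEquiv, Fin.tail]
  rw [hpre, hmp.measure_preimage hs.nullMeasurableSet, Measure.prod_apply_symm hs]
  refine (lintegral_congr fun y => ?_).trans lintegral_zero
  have : NullSingletonClass (μ 0) :=
    nullSingletonClass_gaussianReal one_ne_zero
  refine measure_mono_null (t := {√(q - ∑ i, y i ^ 2), -√(q - ∑ i, y i ^ 2)}) ?_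
    (Set.Finite.measure_zero (Set.toFinite _) _)
  intro a ha
  have ha : a ^ 2 + ∑ i, y i ^ 2 = q := ha
  have h1 : q - ∑ i, y i ^ 2 = a ^ 2 := by linarith
  rw [h1, Real.sqrt_sq_eq_abs]
  rcases abs_choice a with h | h <;> simp [h]

theorem tendsto_measureReal_gt_of_tendstoInDistribution {Ω : ℕ → Type*}
    [∀ n, MeasurableSpace (Ω n)] {P : (n : ℕ) → Measure (Ω n)} [∀ n, IsProbabilityMeasure (P n)]
    {Y : (n : ℕ) → Ω n → ℝ} {μ : Measure ℝ} [IsProbabilityMeasure μ]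
    (h : TendstoInDistribution Y atTop id P μ) {q : ℝ} (hq : μ {q} = 0) :
    Tendsto (fun n => (P n).real {ω | q < Y n ω}) atTop (𝓝 (1 - cdf μ q)) := by
  have h1 := ProbabilityMeasure.tendsto_measure_of_null_frontier_of_tendsto' h.tendsto
    (E := Set.Ioi q) (by
      rw [frontier_Ioi]
      simpa using hq)
  simp only [ProbabilityMeasure.coe_mk, Measure.map_id] at h1
  have h2 := (ENNReal.tendsto_toReal (measure_ne_top _ _)).comp h1
  have h3 : 1 - cdf μ q = μ.real (Set.Ioi q) := by
    rw [cdf_eq_real, ← Set.compl_Iic, probReal_compl_eq_one_sub measurableSet_Iic]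
  rw [h3]
  refine Tendsto.congr (fun n => ?_) h2
  rw [Function.comp_apply, Measure.map_apply_of_aemeasurable (h.forall_aemeasurable n)
    measurableSet_Ioi]
  rfl

end NoncentralChiSq

/-! ### Limit law under the axial alternatives -/

section Bingham

variable {p : ℕ}

local notation "⟪" x ", " y "⟫" => inner ℝ x y

/-- Total mass one determines the normalization, so the explicit constant cancels in a ratio of
uniform integrals and never has to be computed. -/
theorem integral_axialLaw_eq_div (hp : 2 ≤ p) {θ : USphere p} {κ : ℝ} {f : ℝ → ℝ}
    (hf : IsAngularFunction f) [hP : IsProbabilityMeasure (axialLaw θ κ f)] (g : USphere p → ℂ) :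
    ∫ x, g x ∂(axialLaw θ κ f) =
      (∫ x, g x * (f (κ * ⟪(x : EuclideanSpace ℝ (Fin p)), (θ : EuclideanSpace ℝ (Fin p))⟫ ^ 2) : ℂ)
        ∂(uniformSphere p)) /
      (∫ x : USphere p, f (κ * ⟪(x : EuclideanSpace ℝ (Fin p)),
        (θ : EuclideanSpace ℝ (Fin p))⟫ ^ 2) ∂(uniformSphere p) : ℝ) := by
  set σ := (volume : Measure (EuclideanSpace ℝ (Fin p))).toSphere
  set φ : USphere p → ℝ := fun x =>
    f (κ * ⟪(x : EuclideanSpace ℝ (Fin p)), (θ : EuclideanSpace ℝ (Fin p))⟫ ^ 2)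
  have hφ : Measurable φ := hf.mono.measurable.comp (by fun_prop)
  set k : ℝ := axialConst p κ f * Real.Gamma (((p : ℝ) - 1) / 2) /
    (2 * Real.pi ^ (((p : ℝ) - 1) / 2))
  have hden : axialDensity θ κ f = fun x => k * φ x := rfl
  -- The `max` reflects the truncation in `ENNReal.ofReal`; the sign of `k` is not needed.
  have hint (g : USphere p → ℂ) : ∫ x, g x ∂(axialLaw θ κ f) =
      (max k 0 : ℝ) * ∫ x, g x * (φ x : ℂ) ∂σ := by
    rw [axialLaw, hden, integral_withDensity_eq_integral_toReal_smul (by fun_prop)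
      (.of_forall fun _ => ENNReal.ofReal_lt_top), ← integral_const_mul]
    refine integral_congr_ae (.of_forall fun x => ?_)
    have h0 : 0 ≤ φ x := hf.nonneg _
    simp only [ENNReal.toReal_ofReal']
    rw [← zero_mul (φ x), ← max_mul_of_nonneg _ _ h0, Complex.real_smul]
    push_cast
    ring_nf
  have hν (g : USphere p → ℂ) : ∫ x, g x ∂(uniformSphere p) =
      ((σ Set.univ)⁻¹.toReal : ℂ) * ∫ x, g x ∂σ := by
    rw [uniformSphere, integral_smul_measure, Complex.real_smul]
  have hM : ((σ Set.univ)⁻¹.toReal : ℂ) ≠ 0 := by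
    intro h
    have := isProbabilityMeasure_uniformSphere hp
    have h1 := hν fun _ => 1
    rw [h, zero_mul] at h1
    simp at h1
  have h1 := hint fun _ => 1
  simp only [integral_const, probReal_univ, one_smul, one_mul] at h1
  rw [← integral_complex_ofReal, hν, hν, hint, mul_div_mul_left _ _ hM]
  rw [eq_div_iff (right_ne_zero_of_mul (h1 ▸ one_ne_zero))]
  linear_combination (-∫ x, g x * (φ x : ℂ) ∂σ) * h1

theorem tendsto_charFun_sum_outerCoord (hp : 2 ≤ p) {ι : Type*} [Fintype ι]
    (b : OrthonormalBasis ι ℝ (tracelessSymm p)) (θ : USphere p) {f : ℝ → ℝ}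
    (hf : IsAngularFunction f) {κ : ℕ → ℝ} {c : ℝ}
    (hκ : Tendsto (fun n : ℕ => √n * κ n) atTop (𝓝 c)) {Ω : ℕ → Type*}
    [∀ n, MeasurableSpace (Ω n)] (P : (n : ℕ) → Measure (Ω n)) [∀ n, IsProbabilityMeasure (P n)]
    (X : (n : ℕ) → Fin n → Ω n → USphere p) (hindep : ∀ n, iIndepFun (X n) (P n))
    (hlaw : ∀ n i, HasLaw (X n i) (axialLaw θ (κ n) f) (P n)) (t : EuclideanSpace ℝ ι) :
    Tendsto (fun n => charFun ((P n).map fun ω => ∑ i, (√(n : ℝ))⁻¹ • outerCoord b (X n i ω)) t)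
      atTop (𝓝 (Complex.exp ((c * (√(p * (p + 2) / 2) * (2 / (p * (p + 2))) *
        ⟪((b.repr.symm t : tracelessSymm p) : EuclideanSpace ℝ (Fin p × Fin p)),
          centeredOuter θ⟫) : ℝ) * Complex.I - (‖t‖ ^ 2 : ℝ) / 2))) := by
  have := isProbabilityMeasure_uniformSphere hp
  have hc := continuous_outerCoord b
  set h : USphere p → ℝ := fun x =>
    ⟪(x : EuclideanSpace ℝ (Fin p)), (θ : EuclideanSpace ℝ (Fin p))⟫ ^ 2
  set u : USphere p → ℝ := fun x => ⟪outerCoord b x, t⟫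
  have hhc : Continuous h := by fun_prop
  have huc : Continuous u := by fun_prop
  have hh01 (x : USphere p) : h x ∈ Set.Icc (0 : ℝ) 1 := by
    refine ⟨sq_nonneg _, (sq_le_one_iff_abs_le_one _).2 ((abs_real_inner_le_norm _ _).trans ?_)⟩
    simp
  obtain ⟨C, hC⟩ := (isCompact_range huc).isBounded.exists_norm_le
  have huC (x : USphere p) : |u x| ≤ C := hC _ (Set.mem_range_self x)
  have hnum := tendsto_nat_mul_integral_tilted (ν := uniformSphere p) hf hκ huc.measurable huC
    (integral_inner_outerCoord b hp t) hhc.measurable hh01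
  rw [integral_inner_outerCoord_mul b hp θ t, integral_inner_outerCoord_sq b hp t] at hnum
  have hdenom := tendsto_integral_comp_one (ν := uniformSphere p) hf (tendsto_zero_of_sqrt_mul hκ)
    hhc.measurable hh01
  have hlim := hnum.div ((Complex.continuous_ofReal.tendsto _).comp hdenom)
    (by simp)
  rw [Complex.ofReal_one, div_one] at hlim
  refine (Complex.tendsto_one_add_pow_exp_of_tendsto
    (hlim.congr fun n => mul_div_assoc _ _ _)).congr' ?_
  filter_upwards [eventually_gt_atTop 0] with n hn
  -- For `n > 0` the axial law is the law of an actual random vector, hence has mass one.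
  have hprob : IsProbabilityMeasure (axialLaw θ (κ n) f) :=
    (hlaw n ⟨0, hn⟩).isProbabilityMeasure_iff.1 inferInstance
  have hw : Measurable fun x : USphere p => (√(n : ℝ))⁻¹ • outerCoord b x :=
    hc.measurable.const_smul (√(n : ℝ))⁻¹
  have hsum := (((hindep n).comp _ fun _ => hw).charFun_map_fun_sum_eq_prod
    fun i => hw.comp_aemeasurable (hlaw n i).aemeasurable)
  simp only [Function.comp_def] at hsum
  rw [hsum]
  have hone (i : Fin n) : charFun ((P n).map fun ω => (√(n : ℝ))⁻¹ • outerCoord b (X n i ω)) t =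
      1 + (∫ x, (Complex.exp (((u x / √n : ℝ) : ℂ) * Complex.I) - 1) * (f (κ n * h x) : ℂ)
        ∂(uniformSphere p)) / (∫ x, f (κ n * h x) ∂(uniformSphere p) : ℝ) := by
    have hmap : (P n).map (fun ω => (√(n : ℝ))⁻¹ • outerCoord b (X n i ω)) =
        (axialLaw θ (κ n) f).map fun x => (√(n : ℝ))⁻¹ • outerCoord b x := by
      rw [← (hlaw n i).map_eq, AEMeasurable.map_map_of_aemeasurable hw.aemeasurable
        (hlaw n i).aemeasurable]
      rfl
    rw [hmap, charFun_apply, integral_map hw.aemeasurable (by fun_prop),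
      ← integral_axialLaw_eq_div hp hf, integral_sub]
    · simp [u, real_inner_smul_left, div_eq_inv_mul]
    · refine Integrable.of_bound (C := 1) (by fun_prop) (.of_forall fun x => ?_)
      rw [Complex.norm_exp_ofReal_mul_I]
    · exact integrable_const _
  rw [Finset.prod_apply]
  simp [hone, h]

theorem tendstoInDistribution_binghamStat (hp : 2 ≤ p) (θ : USphere p) {f : ℝ → ℝ}
    (hf : IsAngularFunction f) {τ : ℕ → ℝ} {τ₀ : ℝ} (hτ : Tendsto τ atTop (𝓝 τ₀))
    {Ω : ℕ → Type*} [∀ n, MeasurableSpace (Ω n)]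
    (P : (n : ℕ) → Measure (Ω n)) [∀ n, IsProbabilityMeasure (P n)]
    (X : (n : ℕ) → Fin n → Ω n → USphere p)
    (hindep : ∀ n, iIndepFun (X n) (P n))
    (hlaw : ∀ n i, HasLaw (X n i) (axialLaw θ (τ n * p / √(n : ℝ)) f) (P n)) :
    TendstoInDistribution (fun n ω => binghamStat (fun i => X n i ω)) atTop id P
        (noncentralChiSq (binghamDof p) (2 * ((p : ℝ) - 1) * τ₀ ^ 2 / (p + 2))) := by
  have hp1 : (1 : ℝ) < p := by exact_mod_cast hp
  set δ : ℝ := 2 * ((p : ℝ) - 1) * τ₀ ^ 2 / (p + 2) with hδ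
  have hdof : 0 < binghamDof p := by
    have : 2 * 3 ≤ p * (p + 1) := Nat.mul_le_mul hp (by omega)
    unfold binghamDof
    omega
  set m : tracelessSymm p := ⟨centeredOuter θ, centeredOuter_mem (by omega) θ⟩
  have hm2 : ‖m‖ ^ 2 = 1 - 1 / p := norm_centeredOuter_sq (by omega) θ
  have hm2pos : 0 < 1 - 1 / (p : ℝ) := by
    rw [sub_pos, div_lt_one (by linarith)]
    exact hp1
  have hmpos : 0 < ‖m‖ := by
    refine (norm_nonneg m).lt_of_ne' fun h => ?_
    rw [h] at hm2
    simp only [ne_eq, OfNat.ofNat_ne_zero, not_false_eq_true, zero_pow] at hm2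
    linarith
  -- The limiting mean is a multiple of `τ₀ m`, while the reference Gaussian has mean `√δ ≥ 0` along
  -- coordinate 0. The first basis vector is therefore `m/‖m‖` with the sign of `τ₀`.
  obtain ⟨ε, hε, hετ⟩ : ∃ ε : ℝ, ε * ε = 1 ∧ τ₀ * ε = |τ₀| := by
    rcases le_total 0 τ₀ with h | h
    · exact ⟨1, by simp, by simp [abs_of_nonneg h]⟩
    · exact ⟨-1, by simp, by simp [abs_of_nonpos h]⟩
  have hεabs : |ε| = 1 := by
    have : |ε| * |ε| = 1 := by rw [← abs_mul, hε, abs_one]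
    nlinarith [abs_nonneg ε]
  obtain ⟨b, hb⟩ := exists_orthonormalBasis_tracelessSymm hp ((ε * ‖m‖⁻¹) • m)
    (by rw [norm_smul, norm_mul, norm_inv, norm_norm, Real.norm_eq_abs, hεabs, one_mul,
      inv_mul_cancel₀ hmpos.ne']) ⟨0, hdof⟩
  have hmb : m = (ε * ‖m‖) • b ⟨0, hdof⟩ := by
    rw [hb, smul_smul, show ε * ‖m‖ * (ε * ‖m‖⁻¹) = (ε * ε) * (‖m‖ * ‖m‖⁻¹) by ring, hε,
      mul_inv_cancel₀ hmpos.ne', one_mul, one_smul]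
  have hκ : Tendsto (fun n : ℕ => √n * (τ n * p / √(n : ℝ))) atTop (𝓝 (τ₀ * p)) := by
    refine (hτ.mul_const (p : ℝ)).congr' ?_
    filter_upwards [eventually_gt_atTop 0] with n hn
    have : √(n : ℝ) ≠ 0 := by positivity
    field_simp
  have hc := continuous_outerCoord b
  have hae (n : ℕ) : AEMeasurable (fun ω => ∑ i, (√(n : ℝ))⁻¹ • outerCoord b (X n i ω)) (P n) :=
    Finset.aemeasurable_fun_sum _ fun i _ =>
      (hc.measurable.comp_aemeasurable (hlaw n i).aemeasurable).const_smul (√(n : ℝ))⁻¹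
  have hW : TendstoInDistribution
      (fun (n : ℕ) ω => ∑ i, (√(n : ℝ))⁻¹ • outerCoord b (X n i ω)) atTop id P
      (shiftedGaussian (binghamDof p) δ) := by
    refine ⟨hae, aemeasurable_id, ?_⟩
    refine ProbabilityMeasure.tendsto_iff_tendsto_charFun.2 fun t => ?_
    simp only [ProbabilityMeasure.coe_mk, Measure.map_id]
    rw [charFun_shiftedGaussian δ ⟨0, hdof⟩ rfl]
    convert tendsto_charFun_sum_outerCoord hp b θ hf hκ P X hindep hlaw t using 6
    have hinner : ⟪((b.repr.symm t : tracelessSymm p) : EuclideanSpace ℝ (Fin p × Fin p)),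
        centeredOuter θ⟫ = ε * ‖m‖ * t ⟨0, hdof⟩ := by
      rw [show centeredOuter θ = (m : EuclideanSpace ℝ (Fin p × Fin p)) from rfl,
        ← Submodule.coe_inner]
      conv_lhs => rw [hmb]
      rw [real_inner_smul_right, real_inner_comm, ← b.repr_apply_apply,
        LinearIsometryEquiv.apply_symm_apply]
    -- The length of the limiting mean; squaring it with `‖m‖² = 1 - 1/p` yields `δ`.
    have hsqrt : √δ = |τ₀| * p * √(p * (p + 2) / 2) * (2 / (p * (p + 2))) * ‖m‖ := by
      have h2 : √((p : ℝ) * (p + 2) / 2) ^ 2 = p * (p + 2) / 2 := Real.sq_sqrt (by positivity)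
      rw [← Real.sqrt_sq (by positivity : 0 ≤ |τ₀| * p * √(p * (p + 2) / 2) *
        (2 / (p * (p + 2))) * ‖m‖)]
      congr 1
      rw [mul_pow, mul_pow, mul_pow, mul_pow, h2, hm2, sq_abs, hδ]
      field_simp
    rw [hinner, hsqrt, ← hετ]
    ring
  have hQ := hW.continuous_comp (g := fun z => ‖z‖ ^ 2) (by fun_prop)
  have heq : (fun n ω => binghamStat (fun i => X n i ω)) = fun (n : ℕ) =>
      (fun z : EuclideanSpace ℝ (Fin (binghamDof p)) => ‖z‖ ^ 2) ∘
        fun ω => ∑ i, (√(n : ℝ))⁻¹ • outerCoord b (X n i ω) := by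
    ext n ω
    exact binghamStat_eq b (by omega) _
  rw [heq]
  refine ⟨hQ.forall_aemeasurable, aemeasurable_id, ?_⟩
  convert hQ.tendsto using 3
  refine congrArg _ (Subtype.ext ?_)
  simp only [Measure.map_id, Function.comp_id]
  exact (map_norm_sq_shiftedGaussian _ _).symm

end Bingham

theorem mainTheorem4 (p : ℕ) (hp : 2 ≤ p) (θ : USphere p) (f : ℝ → ℝ) (hf : IsAngularFunction f)
    (τ : ℕ → ℝ) (τ₀ : ℝ) (hτ : Tendsto τ atTop (𝓝 τ₀))
    {Ω : ℕ → Type*} [∀ n, MeasurableSpace (Ω n)]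
    (P : (n : ℕ) → Measure (Ω n)) [∀ n, IsProbabilityMeasure (P n)]
    (X : (n : ℕ) → Fin n → Ω n → USphere p)
    (hindep : ∀ n, iIndepFun (X n) (P n))
    (hlaw : ∀ n i, HasLaw (X n i) (axialLaw θ (τ n * p / √(n : ℝ)) f) (P n)) :
    TendstoInDistribution (fun n ω => binghamStat (fun i => X n i ω)) atTop id P
        (noncentralChiSq (binghamDof p) (2 * ((p : ℝ) - 1) * τ₀ ^ 2 / (p + 2))) ∧
      ∀ α ∈ Set.Ioo (0 : ℝ) 1,
        Tendsto
          (fun n => (P n).real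
            {ω | chiSqUpperQuantile (binghamDof p) α < binghamStat (fun i => X n i ω)})
          atTop
          (𝓝 (1 - cdf (noncentralChiSq (binghamDof p) (2 * ((p : ℝ) - 1) * τ₀ ^ 2 / (p + 2)))
            (chiSqUpperQuantile (binghamDof p) α))) := by
  have hdof : 0 < binghamDof p := by
    have : 2 * 3 ≤ p * (p + 1) := Nat.mul_le_mul hp (by omega)
    unfold binghamDof
    omega
  have h := tendstoInDistribution_binghamStat hp θ hf hτ P X hindep hlaw
  exact ⟨h, fun α _ =>
    tendsto_measureReal_gt_of_tendstoInDistribution h (noncentralChiSq_singleton hdof _ _)⟩
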